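/- Let $P$ be a finite poset whose Hasse diagram is a tree. (The Hasse diagram is the graph on the elements of $P$ in which $x$ and $y$ are adjacent if $x<y$ and no $z\in P$ satisfies $x<z<y$, or the same with $x$ and $y$ exchanged.) Say that a poset $Q$ contains $P$ as a subposet if there is an injective map $f\colon P\to Q$ such that $a\le b$ in $P$ implies $f(a)\le f(b)$ in $Q$. Let $h(P)$ be the height of $P$, that is, the number of elements in a longest chain of $P$, and let $\mathrm{ex}(P,n)$ be the size of the largest family $\mathcal{F}\subset 2^{[n]}$ which, ordered by inclusion, does not contain $P$ as a subposet. Then, as $n\to\infty$, $$\mathrm{ex}(P,n)=(h(P)-1)\binom{n}{\lfloor n/2\rfloor}\bigl(1+O(1/n)\bigr),$$ where the implied constant may depend on $P$. Moreover, let $\mathrm{Mon}(\mathbb{Z})$ be the set of all functions $f\colon\mathbb{Z}\to\{0,1\}$ such that $f(n)=1$ and $f(-n)=0$ for all sufficiently large $n$, ordered pointwise. A level of $\mathrm{Mon}(\mathbb{Z})$ is a maximal family $L\subset\mathrm{Mon}(\mathbb{Z})$ such that $\sum_{n\in\mathbb{Z}}(f(n)-g(n))=0$ for all $f,g\in L$.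 Let $l(P)$ be the maximum number of distinct levels of $\mathrm{Mon}(\mathbb{Z})$ whose union does not contain $P$ as a subposet. Then this maximum exists and $l(P)=h(P)-1$. -/

import Mathlib

/-- `P` is a (not necessarily induced) subposet of `Q`: there is an injective
order-preserving map from `P` to `Q`. -/
def IsSubposet (P Q : Type*) [PartialOrder P] [PartialOrder Q] : Prop :=
  ∃ f : P → Q, Function.Injective f ∧ ∀ a b : P, a ≤ b → f a ≤ f b

/-- A set `F` of elements of a poset `Q`, regarded as a poset under the induced order, is `P`-free
if it does not contain `P` as a subposet. -/
def IsPosetFree (P : Type*) {Q : Type*} [PartialOrder P] [PartialOrder Q] (F : Set Q) : Prop :=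
  ¬ IsSubposet P F

open Classical in
/-- The size of the largest `P`-free family of subsets of an `n`-element set, the subsets being
ordered by inclusion. -/
noncomputable def exPoset (P : Type*) [PartialOrder P] (n : ℕ) : ℕ :=
  (Finset.univ.filter fun F : Finset (Finset (Fin n)) =>
    IsPosetFree P (F : Set (Finset (Fin n)))).sup Finset.card

/-- The height of a poset `P`: the number of elements in a longest chain. For finite `P` the value
of `Set.chainHeight` in `ℕ∞` is finite, so `ENat.toNat` does not change it. -/
noncomputable def posetHeight (P : Type*) [PartialOrder P] : ℕ :=
  ((Set.univ : Set P).chainHeight (· ≤ ·)).toNat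

/-- Eventually monotone functions `f : ℤ → {0, 1}`, that is, those with `f n = 1` and `f (-n) = 0`
for all sufficiently large `n`. They are ordered pointwise. -/
abbrev MonZ : Type :=
  {f : ℤ → Fin 2 // ∀ᶠ n : ℤ in Filter.atTop, f n = 1 ∧ f (-n) = 0}

/-- The difference `f n - g n`, as an integer. -/
def monDiff (f g : MonZ) (n : ℤ) : ℤ :=
  ((f.1 n : ℕ) : ℤ) - ((g.1 n : ℕ) : ℤ)

/-- The sum of the differences `f n - g n` over all integers `n` has only finitely many nonzero
terms, so that the `finsum` below is the genuine sum. -/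
theorem monDiff_finite_support (f g : MonZ) : (Function.support (monDiff f g)).Finite := by
  obtain ⟨a, ha⟩ := Filter.eventually_atTop.1 f.2
  obtain ⟨b, hb⟩ := Filter.eventually_atTop.1 g.2
  refine (Set.finite_Icc (-(max a b)) (max a b)).subset fun n hn => ?_
  by_contra hc
  apply hn
  rw [Set.mem_Icc, not_and_or, not_le, not_le] at hc
  have hma := le_max_left a b
  have hmb := le_max_right a b
  rcases hc with h | h
  · have h1 := (ha (-n) (by omega)).2
    have h2 := (hb (-n) (by omega)).2
    rw [neg_neg] at h1 h2
    simp [monDiff, h1, h2]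
  · have h1 := (ha n (by omega)).1
    have h2 := (hb n (by omega)).1
    simp [monDiff, h1, h2]

/-- A level of `MonZ`: a maximal family in which the differences of any two members sum to `0`. -/
def IsMonLevel (L : Set MonZ) : Prop :=
  Maximal (fun K : Set MonZ => ∀ f ∈ K, ∀ g ∈ K, ∑ᶠ n : ℤ, monDiff f g n = 0) L

/-- The possible cardinalities of (finite or infinite) sets of levels of `MonZ` whose union does
not contain `P` as a subposet. The largest one is `l(P)`. -/
def freeLevelCounts (P : Type*) [PartialOrder P] : Set ℕ∞ :=
  {m | ∃ S : Set (Set MonZ), (∀ L ∈ S, IsMonLevel L) ∧ IsPosetFree P (⋃₀ S) ∧ S.encard = m}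

/-! Both halves rest on flexible sets of increasing `k`-tuples, `k = posetHeight P`. A nonempty
flexible set contains every tree poset of height `k` (`isSubposet_of_isFlexible`): strip leaves one
by one, and when a leaf returns, re-extend the tuple through its neighbour so that the entry at the
leaf's rank is a new point.

In the cube, a maximal chain is a numbering of the ground set, and it meets a `P`-free family `F` in
fewer than `|P|` sets. Weight each increasing `k`-tuple from `F` by the number of numberings through
it. If flexibility fails at a tuple, all tuples sharing some end segment `T` with it meet a bounded
set of points outside `T`. Only an `O(1/n)` fraction of the numberings through `T` pass through a
given such point (`supersetCount_insert_le`), so this class of tuples is cheap. Deleting cheap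
classes removes weight `O(1/n) * n!` in all; were the total weight larger, a flexible set would
survive and `F` would contain `P`. A chain with `c` sets from `F` carries at least `c - k + 1`
tuples, so `c` averages at most `k - 1 + O(1/n)` (`sum_card_chain_le`), and the LYM double count
bounds `|F|`. Sets of extreme size are negligible, and `k - 1` levels at the middle give the lower
bound.

In `MonZ` the levels are the classes of an integer degree. The increasing tuples in any `k` levels
form a flexible set, since functions can be altered far from the origin, while `k - 1` levels
contain no chain of `k` elements. -/

/-! ### Height, chains and linear extensions -/

/-- A finite poset of height `k` has a strictly monotone map to `Fin k`. -/
theorem exists_strictMono_fin_posetHeight (P : Type*) [PartialOrder P] [Finite P] :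
    ∃ r : P → Fin (posetHeight P), StrictMono r := by
  have hfin : ∀ s : Set P, s.chainHeight (· ≤ ·) ≠ ⊤ := fun s =>
    Set.chainHeight_ne_top_of_finite _ _ s.toFinite
  -- The rank of `p` is the height of `Set.Iio p`; adjoining `p` to a longest chain there gives a
  -- longer one. `s = univ` bounds the rank, `s = Set.Iio q` makes it strictly monotone.
  have key : ∀ (p : P) (s : Set P), insert p (Set.Iio p) ⊆ s →
      ((Set.Iio p).chainHeight (· ≤ ·)).toNat < (s.chainHeight (· ≤ ·)).toNat := by
    intro p s hs
    obtain ⟨t, ht, htc, htch⟩ := Set.exists_eq_chainHeight_of_finite (Set.Iio p) (· ≤ ·)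
      (Set.toFinite _)
    have hch : IsChain (· ≤ ·) (insert p t) :=
      htch.insert fun b hb _ => Or.inr (ht hb).le
    have h1 := Set.encard_le_chainHeight_of_isChain s (insert p t)
      ((Set.insert_subset_insert ht).trans hs) hch
    rw [Set.encard_insert_of_notMem fun h => lt_irrefl p (ht h), htc] at h1
    have h2 := ENat.toNat_le_toNat h1 (hfin s)
    rw [ENat.toNat_add (hfin _) (by simp)] at h2
    simpa using h2
  refine ⟨fun p => ⟨_, key p Set.univ (Set.subset_univ _)⟩, fun p q hpq => ?_⟩
  refine key p (Set.Iio q) ?_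
  rintro x (rfl | hx)
  · exact hpq
  · exact lt_trans hx hpq

/-- A finite poset has a chain with as many elements as its height. -/
theorem exists_finset_isChain_card_eq_posetHeight (P : Type*) [PartialOrder P] [Finite P] :
    ∃ c : Finset P, IsChain (· ≤ ·) (c : Set P) ∧ c.card = posetHeight P := by
  obtain ⟨t, -, htc, htch⟩ := Set.exists_eq_chainHeight_of_finite (Set.univ : Set P) (· ≤ ·)
    (Set.toFinite _)
  refine ⟨t.toFinite.toFinset, by simpa using htch, ?_⟩
  rw [posetHeight, ← htc, ← Set.ncard_eq_toFinset_card t]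
  rfl

theorem posetHeight_pos (P : Type*) [PartialOrder P] [Finite P] [Nonempty P] :
    0 < posetHeight P := by
  obtain ⟨r, -⟩ := exists_strictMono_fin_posetHeight P
  exact (Nat.zero_le _).trans_lt (r (Classical.arbitrary P)).2

/-- A set on which some function is strictly monotone with fewer than `posetHeight P` values does
not contain `P`. -/
theorem isPosetFree_of_strictMonoOn {P Q β : Type*} [PartialOrder P] [Finite P] [PartialOrder Q]
    [Preorder β] (F : Set Q) (d : Q → β) (hd : StrictMonoOn d F) (V : Finset β)
    (hV : ∀ x ∈ F, d x ∈ V) (hcard : V.card < posetHeight P) : IsPosetFree P F := by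
  rintro ⟨f, hf, hmono⟩
  obtain ⟨c, hc, hcc⟩ := exists_finset_isChain_card_eq_posetHeight P
  have hlt : ∀ a b, a < b → d (f a) < d (f b) := fun a b hab =>
    hd (f a).2 (f b).2 (lt_of_le_of_ne (hmono a b hab.le) fun h => hab.ne (hf (Subtype.ext h)))
  obtain ⟨x, hx, y, hy, hne, hxy⟩ := Finset.exists_ne_map_eq_of_card_lt_of_maps_to
    (s := c) (t := V) (f := fun a => d (f a)) (hcc ▸ hcard) fun a _ => hV _ (f a).2
  rcases hc hx hy hne with h | h
  · exact (hlt _ _ (lt_of_le_of_ne h hne)).ne hxy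
  · exact (hlt _ _ (lt_of_le_of_ne h hne.symm)).ne hxy.symm

/-- A finite chain is enumerated increasingly by an initial segment of `ℕ`. -/
theorem exists_strictMono_enum_of_isChain {Q : Type*} [PartialOrder Q] (c : Finset Q)
    (hc : IsChain (· ≤ ·) (c : Set Q)) :
    ∃ e : Fin c.card → Q, StrictMono e ∧ ∀ i, e i ∈ c := by
  classical
  let : LinearOrder c :=
    { (inferInstance : PartialOrder c) with
      le_total := fun a b => hc.total a.2 b.2
      toDecidableLE := Classical.decRel _ }
  let e := Fintype.orderIsoFinOfCardEq c (Fintype.card_coe c)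
  exact ⟨fun i => (e i : c), fun i j hij => e.strictMono hij, fun i => (e i).2⟩

/-- Every poset embeds into a chain with at least as many elements. -/
theorem isSubposet_of_strictMono_fin {P Q : Type*} [PartialOrder P] [Finite P] [PartialOrder Q]
    (F : Set Q) {m : ℕ} (hm : Nat.card P ≤ m) (e : Fin m → Q) (he : StrictMono e)
    (heF : ∀ i, e i ∈ F) : IsSubposet P F := by
  classical
  have : Fintype (LinearExtension P) := @Fintype.ofFinite _ (inferInstanceAs (Finite P))
  let g := (Fintype.orderIsoFinOfCardEq (LinearExtension P) (k := Nat.card P)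
    (by rw [← Nat.card_eq_fintype_card]; rfl)).symm
  refine ⟨fun p => ⟨e (Fin.castLE hm (g (toLinearExtension p))), heF _⟩, fun a b hab => ?_,
    fun a b hab => ?_⟩
  · have h1 := Fin.castLE_injective hm (he.injective (Subtype.ext_iff.1 hab))
    exact g.injective h1
  · exact he.monotone (by simpa using toLinearExtension.monotone hab)

/-- A function on a finite poset that respects covering pairs is strictly monotone. -/
theorem strictMono_of_covBy {P Q : Type*} [PartialOrder P] [Finite P] [PartialOrder Q]
    (f : P → Q) (h : ∀ a b, a ⋖ b → f a < f b) : StrictMono f := by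
  classical
  have := Fintype.ofFinite P
  have : LocallyFiniteOrder P := Fintype.toLocallyFiniteOrder
  exact (strictMono_iff_forall_covBy f).2 fun a b hab => h a b hab

/-! ### Flexible sets of tuples and greedy embedding of trees -/

/-- A set of `k`-tuples is *flexible* up to size `m` if each initial or final segment of each of its
members extends to a member of the set whose other entries avoid any given `m` elements. -/
def IsFlexible {Q : Type*} {k : ℕ} (m : ℕ) (R : Set (Fin k → Q)) : Prop :=
  ∀ t ∈ R, ∀ a : Fin k, ∀ u : Finset (Fin k), u = Finset.Ici a ∨ u = Finset.Iic a →
    ∀ S : Finset Q, S.card ≤ m → ∃ t' ∈ R, (∀ i ∈ u, t' i = t i) ∧ ∀ i ∉ u, t' i ∉ S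

/-- Trees can be embedded greedily into a flexible set of increasing tuples. -/
theorem exists_embedding_of_isTree {Q : Type*} [PartialOrder Q] {k m : ℕ}
    (R : Set (Fin k → Q)) (hne : R.Nonempty) (hmono : ∀ t ∈ R, StrictMono t)
    (hflex : IsFlexible m R) (N : ℕ) :
    ∀ (V : Type*) [Finite V] (G : SimpleGraph V) (r : V → Fin k), Nat.card V = N → N ≤ m →
      G.IsTree → (∀ a b, G.Adj a b → r a ≠ r b) →
      ∃ f : V → Q, Function.Injective f ∧ (∀ v, ∃ t ∈ R, t (r v) = f v) ∧
        ∀ a b, G.Adj a b → r a < r b → f a < f b := by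
  classical
  induction N with
  | zero =>
    intro V _ G r hV _ hG _
    have := hG.1.nonempty
    exact absurd hV Nat.card_pos.ne'
  | succ N ih =>
    intro V _ G r hV hNm hG hr
    have := Fintype.ofFinite V
    rcases subsingleton_or_nontrivial V with hs | hs
    · obtain ⟨t, ht⟩ := hne
      exact ⟨fun v => t (r v), fun a b _ => Subsingleton.elim _ _, fun v => ⟨t, ht, rfl⟩,
        fun a b hab => absurd (Subsingleton.elim a b) hab.ne⟩
    obtain ⟨v, hv⟩ := hG.exists_vert_degree_one_of_nontrivial
    have hconn := hG.1.induce_compl_singleton_of_degree_eq_one hv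
    have htree : (G.induce ({v}ᶜ : Set V)).IsTree := ⟨hconn, hG.2.induce _⟩
    obtain ⟨w, hw, hwu⟩ := SimpleGraph.degree_eq_one_iff_existsUnique_adj.1 hv
    have hcard : Nat.card ({v}ᶜ : Set V) = N := by
      have := Set.ncard_add_ncard_compl ({v} : Set V)
      rw [Set.ncard_singleton, hV] at this
      rw [Nat.card_coe_set_eq]; omega
    obtain ⟨f, hfi, hft, hfm⟩ := ih ({v}ᶜ : Set V) (G.induce _) (fun x => r x) hcard (by omega)
      htree (fun a b hab => hr _ _ hab)
    have hwv : w ∈ ({v}ᶜ : Set V) := by simpa using hw.ne'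
    obtain ⟨t, ht, htw⟩ := hft ⟨w, hwv⟩
    let S : Finset Q := Finset.univ.image f
    have hS : S.card ≤ m := by
      refine Finset.card_image_le.trans ?_
      rw [Finset.card_univ, ← Nat.card_eq_fintype_card, hcard]; omega
    -- The leaf `v` has the single neighbour `w`. Keep the end segment of `t` that starts at rank `r
    -- w` and points away from `r v`; the new entry at `r v` is then fresh and comparable to `f w`
    -- in the right direction.
    obtain ⟨t', ht', hfresh, hlt, hgt⟩ : ∃ t' ∈ R, t' (r v) ∉ S ∧
        (r v < r w → t' (r v) < f ⟨w, hwv⟩) ∧ (r w < r v → f ⟨w, hwv⟩ < t' (r v)) := by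
      rcases lt_or_gt_of_ne (hr _ _ hw) with h | h
      · obtain ⟨t', ht', h1, h2⟩ := hflex t ht (r w) _ (Or.inl rfl) S hS
        refine ⟨t', ht', h2 _ (by simpa using h), fun _ => ?_, fun h' => absurd h' h.asymm⟩
        rw [← htw, ← h1 (r w) (by simp)]
        exact hmono t' ht' h
      · obtain ⟨t', ht', h1, h2⟩ := hflex t ht (r w) _ (Or.inr rfl) S hS
        refine ⟨t', ht', h2 _ (by simpa using h), fun h' => absurd h' h.asymm, fun _ => ?_⟩
        rw [← htw, ← h1 (r w) (by simp)]
        exact hmono t' ht' h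
    have hnotS : ∀ x, f x ≠ t' (r v) := fun x hx =>
      hfresh (hx ▸ Finset.mem_image_of_mem f (Finset.mem_univ x))
    refine ⟨fun x => if hx : x = v then t' (r v) else f ⟨x, hx⟩, ?_, ?_, ?_⟩
    · intro a b hab
      by_cases ha : a = v <;> by_cases hb : b = v
      · rw [ha, hb]
      · simp only [ha, hb, dif_pos, dif_neg, not_false_eq_true] at hab
        exact absurd hab.symm (hnotS _)
      · simp only [ha, hb, dif_pos, dif_neg, not_false_eq_true] at hab
        exact absurd hab (hnotS _)
      · simp only [ha, hb, dif_neg, not_false_eq_true] at hab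
        exact Subtype.ext_iff.1 (hfi hab)
    · intro x
      by_cases hx : x = v
      · exact ⟨t', ht', by simp [hx]⟩
      · obtain ⟨s, hs, h⟩ := hft ⟨x, hx⟩
        exact ⟨s, hs, by simpa [hx] using h⟩
    · intro a b hab hrab
      by_cases ha : a = v
      · subst ha
        obtain rfl := hwu b hab
        have hb := hab.ne'
        simpa [hb] using hlt hrab
      · by_cases hb : b = v
        · subst hb
          obtain rfl := hwu a hab.symm
          simpa [ha] using hgt hrab
        · simpa [ha, hb] using hfm ⟨a, ha⟩ ⟨b, hb⟩ hab hrab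

/-- A poset whose Hasse diagram is a tree is contained in every flexible nonempty set of increasing
tuples as long as its height. -/
theorem isSubposet_of_isFlexible {P Q : Type*} [PartialOrder P] [Finite P] [PartialOrder Q]
    (hP : (SimpleGraph.hasse P).IsTree) (F : Set Q) (R : Set (Fin (posetHeight P) → Q))
    (hne : R.Nonempty) (hmono : ∀ t ∈ R, StrictMono t) (hF : ∀ t ∈ R, ∀ i, t i ∈ F)
    (hflex : IsFlexible (Nat.card P) R) : IsSubposet P F := by
  obtain ⟨r, hr⟩ := exists_strictMono_fin_posetHeight P
  obtain ⟨f, hfi, hft, hfm⟩ := exists_embedding_of_isTree R hne hmono hflex _ P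
    (SimpleGraph.hasse P) r rfl le_rfl hP
    (fun a b hab => hab.elim (fun h => (hr h.lt).ne) fun h => (hr h.lt).ne')
  have hf : StrictMono f := strictMono_of_covBy f fun a b hab => hfm a b (Or.inl hab) (hr hab.lt)
  have hmem : ∀ p, f p ∈ F := fun p => by
    obtain ⟨t, ht, h⟩ := hft p
    exact h ▸ hF t ht _
  exact ⟨fun p => ⟨f p, hmem p⟩, fun a b hab => hfi (Subtype.ext_iff.1 hab),
    fun a b hab => hf.monotone hab⟩

/-! ### Deleting cheap classes -/

/-- Iterated removal of cheap classes: if every nonempty subset of `R` either satisfies `p` or has a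
class of one of the labelings `res u` whose weight is at most its cost, then a subset satisfying `p`
exists as soon as the weight of `R` exceeds the total cost of all classes. -/
theorem exists_subset_of_cheap_classes {α β κ : Type*} [DecidableEq α] [DecidableEq β]
    (𝒰 : Finset κ) (res : κ → α → β) (w : α → ℝ) (c : κ → β → ℝ) (hc : ∀ u b, 0 ≤ c u b)
    (p : Finset α → Prop) (R : Finset α)
    (hbad : ∀ R' ⊆ R, R'.Nonempty → ¬ p R' → ∃ u ∈ 𝒰, ∃ t ∈ R',
      ∑ t' ∈ R' with res u t' = res u t, w t' ≤ c u (res u t))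
    (hlarge : ∑ u ∈ 𝒰, ∑ b ∈ R.image (res u), c u b < ∑ t ∈ R, w t) :
    ∃ R' ⊆ R, R'.Nonempty ∧ p R' := by
  induction hn : R.card using Nat.strong_induction_on generalizing R with
  | _ n ih =>
    have hne : R.Nonempty := by
      rw [Finset.nonempty_iff_ne_empty]
      rintro rfl
      simp at hlarge
    by_cases hp : p R
    · exact ⟨R, subset_rfl, hne, hp⟩
    obtain ⟨u, hu, t, ht, hle⟩ := hbad R subset_rfl hne hp
    set R₁ := R.filter fun t' => ¬ res u t' = res u t with hR₁
    have hsub : R₁ ⊆ R := Finset.filter_subset _ _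
    have hlt : R₁.card < n := by
      rw [← hn]
      exact Finset.card_lt_card (Finset.filter_ssubset.2 ⟨t, ht, by simp⟩)
    have hw := Finset.sum_filter_add_sum_filter_not R (fun t' => res u t' = res u t) w
    -- The label of the deleted class no longer occurs, so each class is paid for at most once and
    -- the strict inequality survives the deletion.
    have hcost : ∑ u' ∈ 𝒰, ∑ b ∈ R₁.image (res u'), c u' b + c u (res u t) ≤
        ∑ u' ∈ 𝒰, ∑ b ∈ R.image (res u'), c u' b := by
      classical
      rw [← Finset.add_sum_erase _ _ hu, ← Finset.add_sum_erase _ _ hu]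
      have h1 : ∑ b ∈ R₁.image (res u), c u b + c u (res u t) ≤
          ∑ b ∈ R.image (res u), c u b := by
        have hnot : res u t ∉ R₁.image (res u) := by simp [hR₁]
        rw [add_comm, ← Finset.sum_insert hnot]
        refine Finset.sum_le_sum_of_subset_of_nonneg ?_ fun _ _ _ => hc _ _
        exact Finset.insert_subset (Finset.mem_image_of_mem _ ht) (Finset.image_subset_image hsub)
      have h2 : ∑ u' ∈ 𝒰.erase u, ∑ b ∈ R₁.image (res u'), c u' b ≤
          ∑ u' ∈ 𝒰.erase u, ∑ b ∈ R.image (res u'), c u' b :=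
        Finset.sum_le_sum fun u' _ => Finset.sum_le_sum_of_subset_of_nonneg
          (Finset.image_subset_image hsub) fun _ _ _ => hc _ _
      linarith
    obtain ⟨R', hR', h⟩ := ih _ hlt R₁ (fun R' h => hbad R' (h.trans hsub))
      (by rw [← hR₁] at hw; linarith) rfl
    exact ⟨R', hR'.trans hsub, h⟩

/-! ### Counting tuples along a family of chains -/

open Classical in
/-- The number of members of a family of finite sets that contain `T`. -/
noncomputable def supersetCount {Ω Q : Type*} [Fintype Ω] (C : Ω → Finset Q) (T : Finset Q) : ℕ :=
  (Finset.univ.filter fun ω => T ⊆ C ω).card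

theorem supersetCount_eq_card {Ω Q : Type*} [Fintype Ω] {C : Ω → Finset Q} {T : Finset Q}
    (s : Finset Ω) (h : ∀ ω, ω ∈ s ↔ T ⊆ C ω) : supersetCount C T = s.card := by
  unfold supersetCount
  congr 1
  ext ω
  simp [h]

/-- The initial and final segments of `Fin k`. -/
def endSegments (k : ℕ) : Finset (Finset (Fin k)) :=
  Finset.univ.image Finset.Ici ∪ Finset.univ.image Finset.Iic

theorem mem_endSegments {k : ℕ} {u : Finset (Fin k)} :
    u ∈ endSegments k ↔ ∃ a, u = Finset.Ici a ∨ u = Finset.Iic a := by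
  simp only [endSegments, Finset.mem_union, Finset.mem_image, Finset.mem_univ, true_and, exists_or,
    eq_comm]

/-- The restriction of a tuple to a set of indices, as a partial function. -/
def restrictTuple {Q : Type*} {k : ℕ} (u : Finset (Fin k)) (t : Fin k → Q) (i : Fin k) : Option Q :=
  if i ∈ u then some (t i) else none

theorem eq_of_restrictTuple_eq {Q : Type*} {k : ℕ} {u : Finset (Fin k)} {t t' : Fin k → Q}
    (h : restrictTuple u t' = restrictTuple u t) {i : Fin k} (hi : i ∈ u) : t' i = t i := by
  simpa [restrictTuple, hi] using congrFun h i

open Classical in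
/-- The entries of a partial function. -/
noncomputable def tupleEntries {Q : Type*} {k : ℕ} (b : Fin k → Option Q) : Finset Q :=
  Finset.univ.biUnion fun i => (b i).toFinset

open Classical in
theorem tupleEntries_restrictTuple {Q : Type*} {k : ℕ} (u : Finset (Fin k)) (t : Fin k → Q) :
    tupleEntries (restrictTuple u t) = u.image t := by
  ext q
  simp only [tupleEntries, restrictTuple, Finset.mem_biUnion, Finset.mem_univ, true_and,
    Option.mem_toFinset, Option.mem_def, Finset.mem_image]
  constructor
  · rintro ⟨i, hi⟩
    by_cases h : i ∈ u
    · exact ⟨i, h, by simpa [h] using hi⟩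
    · simp [h] at hi
  · rintro ⟨i, hi, rfl⟩
    exact ⟨i, by simp [hi]⟩

open Classical in
/-- The increasing `k`-tuples with entries in `c`. -/
noncomputable def increasingTuples {Q : Type*} [PartialOrder Q] (k : ℕ) (c : Finset Q) :
    Finset (Fin k → Q) :=
  (Fintype.piFinset fun _ => c).filter StrictMono

theorem mem_increasingTuples {Q : Type*} [PartialOrder Q] {k : ℕ} {c : Finset Q} {t : Fin k → Q} :
    t ∈ increasingTuples k c ↔ (∀ i, t i ∈ c) ∧ StrictMono t := by
  simp [increasingTuples]

theorem card_increasingTuples_le {Q : Type*} [PartialOrder Q] (k : ℕ) (c : Finset Q) :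
    (increasingTuples k c).card ≤ c.card ^ k := by
  classical
  refine (Finset.card_filter_le _ _).trans ?_
  simp

/-- A chain of `m` elements has at least `m - k + 1` increasing `k`-tuples. -/
theorem card_le_card_increasingTuples_add {Q : Type*} [PartialOrder Q] {k : ℕ} (hk : 0 < k)
    (c : Finset Q) (hc : IsChain (· ≤ ·) (c : Set Q)) :
    c.card + 1 ≤ (increasingTuples k c).card + k := by
  classical
  obtain ⟨e, he, hec⟩ := exists_strictMono_enum_of_isChain c hc
  by_cases hck : c.card + 1 ≤ k
  · omega
  -- Windows of `k` consecutive elements of the chain.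
  let g : Fin (c.card + 1 - k) → Fin k → Q := fun j i => e ⟨j + i, by omega⟩
  have hg : Function.Injective g := fun a b hab => by
    have := he.injective (congrFun hab ⟨0, hk⟩)
    simpa [Fin.ext_iff] using this
  have := Finset.card_le_card_of_injOn (s := Finset.univ) (t := increasingTuples k c) g
    (fun j _ => mem_increasingTuples.2 ⟨fun i => hec _, fun i i' h => he
      (Fin.mk_lt_mk.2 (Nat.add_lt_add_left h _))⟩) hg.injOn
  simp only [Finset.card_univ, Fintype.card_fin] at this
  omega

section Counting

variable {Ω Q : Type*} [Fintype Ω] (C : Ω → Finset Q)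

-- Double counting of pairs of a tuple and a chain through all its entries.
open Classical in
theorem sum_supersetCount_image {k : ℕ} (R : Finset (Fin k → Q)) :
    ∑ t ∈ R, supersetCount C (Finset.univ.image t) =
      ∑ ω, (R.filter fun t => ∀ i, t i ∈ C ω).card := by
  simp only [supersetCount, Finset.card_filter]
  rw [Finset.sum_comm]
  simp [Finset.image_subset_iff]

/-- `g` lies strictly below the least element of `T` or strictly above its greatest one. -/
def IsOutside [PartialOrder Q] (g : Q) (T : Finset Q) : Prop :=
  ∃ a ∈ T, (g < a ∧ ∀ b ∈ T, a ≤ b) ∨ (a < g ∧ ∀ b ∈ T, b ≤ a)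

-- This is what end segments are for: no remaining entry falls between two fixed ones, where the
-- exchange argument could give only a constant fraction.
open Classical in
theorem isOutside_image [PartialOrder Q] {k : ℕ} {t : Fin k → Q} (ht : StrictMono t) {u : Finset (Fin k)}
    (hu : u ∈ endSegments k) {i : Fin k} (hi : i ∉ u) : IsOutside (t i) (u.image t) := by
  obtain ⟨a, rfl | rfl⟩ := mem_endSegments.1 hu
  · refine ⟨t a, Finset.mem_image_of_mem _ (by simp), Or.inl ⟨ht (by simpa using hi), ?_⟩⟩
    simp only [Finset.mem_image, Finset.mem_Ici, forall_exists_index, and_imp]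
    rintro _ j hj rfl
    exact ht.monotone hj
  · refine ⟨t a, Finset.mem_image_of_mem _ (by simp), Or.inr ⟨ht (by simpa using hi), ?_⟩⟩
    simp only [Finset.mem_image, Finset.mem_Iic, forall_exists_index, and_imp]
    rintro _ j hj rfl
    exact ht.monotone hj

open Classical in
/-- If all members of a class of increasing tuples with the same restriction to an end segment
meet a small set outside that segment, then the class is cheap. -/
theorem sum_class_le [PartialOrder Q] {k m : ℕ} {δ : ℝ} (hδ : 0 ≤ δ) (hC : ∀ ω, (C ω).card < m)
    (hout : ∀ T g, IsOutside g T → (supersetCount C (insert g T) : ℝ) ≤ δ * supersetCount C T)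
    (R : Finset (Fin k → Q)) (hR : ∀ t ∈ R, StrictMono t) {u : Finset (Fin k)}
    (hu : u ∈ endSegments k) (t : Fin k → Q) (S : Finset Q) (hS : S.card ≤ m)
    (hmeet : ∀ t' ∈ R, restrictTuple u t' = restrictTuple u t → ∃ i ∉ u, t' i ∈ S) :
    ∑ t' ∈ R with restrictTuple u t' = restrictTuple u t,
        (supersetCount C (Finset.univ.image t') : ℝ) ≤
      m ^ k * m * δ * supersetCount C (tupleEntries (restrictTuple u t)) := by
  rw [tupleEntries_restrictTuple]
  set R₁ := R.filter fun t' => restrictTuple u t' = restrictTuple u t with hR₁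
  set T := u.image t with hT
  have himg : ∀ t' ∈ R₁, u.image t' = T := fun t' ht' =>
    Finset.image_congr fun i hi => eq_of_restrictTuple_eq (Finset.mem_filter.1 ht').2 hi
  set S₁ := S.filter fun g => IsOutside g T
  -- A chain contains at most `m ^ k` tuples of the class, and if it contains any, it passes through
  -- `T` and some point of `S` outside `T`.
  have hpt : ∀ ω, (R₁.filter fun t' => ∀ i, t' i ∈ C ω).card ≤
      m ^ k * ∑ g ∈ S₁, if insert g T ⊆ C ω then 1 else 0 := by
    intro ω
    have hcard : (R₁.filter fun t' => ∀ i, t' i ∈ C ω).card ≤ m ^ k := by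
      refine (Finset.card_le_card fun t' ht' => ?_).trans
        ((card_increasingTuples_le k (C ω)).trans (Nat.pow_le_pow_left (hC ω).le k))
      rw [Finset.mem_filter] at ht'
      exact mem_increasingTuples.2 ⟨ht'.2, hR _ (Finset.mem_filter.1 ht'.1).1⟩
    rcases Finset.eq_empty_or_nonempty (R₁.filter fun t' => ∀ i, t' i ∈ C ω) with h | ⟨t', h⟩
    · simp [h]
    · rw [Finset.mem_filter] at h
      obtain ⟨ht', hω⟩ := h
      have htR := Finset.mem_filter.1 ht'
      obtain ⟨i, hi, hiS⟩ := hmeet t' htR.1 htR.2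
      have hg : t' i ∈ S₁ := Finset.mem_filter.2 ⟨hiS, by
        rw [← himg t' ht']
        exact isOutside_image (hR _ htR.1) hu hi⟩
      have hsub : insert (t' i) T ⊆ C ω := by
        rw [← himg t' ht']
        refine Finset.insert_subset (hω i) ?_
        rw [Finset.image_subset_iff]
        exact fun j _ => hω j
      have hone : 1 ≤ ∑ g ∈ S₁, if insert g T ⊆ C ω then 1 else 0 := by
        refine le_trans ?_ (Finset.single_le_sum (f := fun g => if insert g T ⊆ C ω then 1 else 0)
          (fun _ _ => Nat.zero_le _) hg)
        simp [hsub]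
      exact hcard.trans (Nat.le_mul_of_pos_right _ hone)
  have h1 : ∑ t' ∈ R₁, supersetCount C (Finset.univ.image t') ≤
      m ^ k * ∑ g ∈ S₁, supersetCount C (insert g T) := by
    rw [sum_supersetCount_image]
    refine (Finset.sum_le_sum fun ω _ => hpt ω).trans ?_
    rw [← Finset.mul_sum, Finset.sum_comm]
    simp only [supersetCount, Finset.card_filter]
    exact le_rfl
  have h2 : ∑ g ∈ S₁, (supersetCount C (insert g T) : ℝ) ≤ m * (δ * supersetCount C T) := by
    refine (Finset.sum_le_card_nsmul S₁ _ (δ * supersetCount C T) fun g hg =>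
      hout T g (Finset.mem_filter.1 hg).2).trans ?_
    rw [nsmul_eq_mul]
    refine mul_le_mul_of_nonneg_right ?_ (by positivity)
    exact_mod_cast (Finset.card_filter_le _ _).trans hS
  calc ∑ t' ∈ R₁, (supersetCount C (Finset.univ.image t') : ℝ)
      ≤ m ^ k * ∑ g ∈ S₁, (supersetCount C (insert g T) : ℝ) := by exact_mod_cast h1
    _ ≤ m ^ k * (m * (δ * supersetCount C T)) := by gcongr
    _ = _ := by ring

-- Each entry of a partial tuple inside `C ω` is a point of `C ω` or `none`; the strict bound on `(C
-- ω).card` leaves room for the extra value.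
open Classical in
theorem sum_supersetCount_tupleEntries_le {k m : ℕ} (hC : ∀ ω, (C ω).card < m)
    (B : Finset (Fin k → Option Q)) :
    ∑ b ∈ B, supersetCount C (tupleEntries b) ≤ m ^ k * Fintype.card Ω := by
  simp only [supersetCount, Finset.card_filter]
  rw [Finset.sum_comm, mul_comm, ← smul_eq_mul]
  refine Finset.sum_le_card_nsmul _ _ _ fun ω _ => ?_
  rw [← Finset.card_filter]
  calc (B.filter fun b => tupleEntries b ⊆ C ω).card
      ≤ (Fintype.piFinset fun _ : Fin k => Finset.insertNone (C ω)).card := by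
        refine Finset.card_le_card fun b hb => ?_
        rw [Fintype.mem_piFinset]
        intro i
        rw [Finset.mem_insertNone]
        intro q hq
        refine (Finset.mem_filter.1 hb).2 ?_
        simp only [tupleEntries, Finset.mem_biUnion]
        exact ⟨i, Finset.mem_univ _, by simpa using hq⟩
    _ = ((C ω).card + 1) ^ k := by simp
    _ ≤ m ^ k := Nat.pow_le_pow_left (hC ω) k

/-- If few members of a family of chains pass through a given point outside a given set of points
of a chain, then the chains have few surplus points, unless their union contains `P`. -/
theorem sum_card_chain_le [PartialOrder Q] {P : Type*} [PartialOrder P] [Finite P]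
    (hP : (SimpleGraph.hasse P).IsTree) (F : Set Q) (hF : IsPosetFree P F) {δ : ℝ} (hδ : 0 ≤ δ)
    (hchain : ∀ ω, IsChain (· ≤ ·) (C ω : Set Q)) (hCF : ∀ ω, (C ω : Set Q) ⊆ F)
    (hout : ∀ (T : Finset Q) (T' : Finset Q) g, (T' : Set Q) = insert g (T : Set Q) →
      IsOutside g T → (supersetCount C T' : ℝ) ≤ δ * supersetCount C T) :
    ∑ ω, ((C ω).card : ℝ) ≤ ((posetHeight P : ℝ) - 1 + (endSegments (posetHeight P)).card *
      (Nat.card P : ℝ) ^ (2 * posetHeight P + 1) * δ) * Fintype.card Ω := by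
  classical
  have := hP.1.nonempty
  set k := posetHeight P
  set m := Nat.card P
  have hk : 0 < k := posetHeight_pos P
  have hC : ∀ ω, (C ω).card < m := by
    intro ω
    by_contra! h
    obtain ⟨e, he, hec⟩ := exists_strictMono_enum_of_isChain _ (hchain ω)
    exact hF (isSubposet_of_strictMono_fin F h e he fun i => hCF ω (hec i))
  set R := Finset.univ.biUnion fun ω => increasingTuples k (C ω) with hR
  have hRm : ∀ t ∈ R, StrictMono t ∧ ∀ i, t i ∈ F := by
    intro t ht
    obtain ⟨ω, -, h⟩ := Finset.mem_biUnion.1 ht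
    rw [mem_increasingTuples] at h
    exact ⟨h.2, fun i => hCF ω (h.1 i)⟩
  have hsum : ∑ t ∈ R, (supersetCount C (Finset.univ.image t) : ℝ) =
      ∑ ω, ((increasingTuples k (C ω)).card : ℝ) := by
    have : ∀ ω, R.filter (fun t => ∀ i, t i ∈ C ω) = increasingTuples k (C ω) := by
      intro ω
      ext t
      rw [Finset.mem_filter, mem_increasingTuples]
      refine ⟨fun h => ⟨h.2, (hRm t h.1).1⟩, fun h => ⟨?_, h.1⟩⟩
      exact Finset.mem_biUnion.2 ⟨ω, Finset.mem_univ _, mem_increasingTuples.2 h⟩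
    have h := sum_supersetCount_image C R
    simp only [this] at h
    exact_mod_cast h
  have hcost : ∑ u ∈ endSegments k, ∑ b ∈ R.image (restrictTuple u),
      (m : ℝ) ^ k * m * δ * supersetCount C (tupleEntries b) ≤
      (endSegments k).card * (m : ℝ) ^ (2 * k + 1) * δ * Fintype.card Ω := by
    calc _ ≤ ∑ u ∈ endSegments k, (m : ℝ) ^ k * m * δ * (m ^ k * Fintype.card Ω) := by
          refine Finset.sum_le_sum fun u _ => ?_
          rw [← Finset.mul_sum]
          have := sum_supersetCount_tupleEntries_le C hC (R.image (restrictTuple u))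
          refine mul_le_mul_of_nonneg_left ?_ (by positivity)
          exact_mod_cast this
      _ = _ := by
          rw [Finset.sum_const, nsmul_eq_mul]
          ring
  -- Otherwise the weight exceeds the cost of all classes, a flexible subset survives the deletions,
  -- and `F` contains `P`.
  have hle : ∑ ω, ((increasingTuples k (C ω)).card : ℝ) ≤
      (endSegments k).card * (m : ℝ) ^ (2 * k + 1) * δ * Fintype.card Ω := by
    by_contra! hlt
    obtain ⟨R', hR', hne, hflex⟩ := exists_subset_of_cheap_classes (endSegments k) restrictTuple
      (fun t => (supersetCount C (Finset.univ.image t) : ℝ))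
      (fun _ b => (m : ℝ) ^ k * m * δ * supersetCount C (tupleEntries b))
      (fun _ _ => by positivity) (fun R' => IsFlexible m (R' : Set (Fin k → Q))) R
      (by
        intro R' hR' hne hnf
        simp only [IsFlexible, not_forall] at hnf
        obtain ⟨t, ht, a, u, hu, S, hS, hno⟩ := hnf
        have hu' : u ∈ endSegments k := mem_endSegments.2 ⟨a, hu⟩
        refine ⟨u, hu', t, ht, sum_class_le C hδ hC ?_ R' (fun t ht => (hRm t (hR' ht)).1) hu' t S
          hS ?_⟩
        · intro T g hg
          exact hout T _ g (by simp) hg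
        · intro t' ht' heq
          by_contra! hcon
          exact hno ⟨t', ht', fun i hi => eq_of_restrictTuple_eq heq hi, hcon⟩)
      (by rw [hsum]; exact hcost.trans_lt hlt)
    exact hF (isSubposet_of_isFlexible hP F R' hne (fun t ht => (hRm t (hR' ht)).1)
      (fun t ht => (hRm t (hR' ht)).2) hflex)
  have hpt : ∀ ω, ((C ω).card : ℝ) ≤ (increasingTuples k (C ω)).card + ((k : ℝ) - 1) := by
    intro ω
    have := card_le_card_increasingTuples_add hk (C ω) (hchain ω)
    have : ((C ω).card : ℝ) + 1 ≤ (increasingTuples k (C ω)).card + k := by exact_mod_cast this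
    linarith
  calc ∑ ω, ((C ω).card : ℝ) ≤ ∑ ω, ((increasingTuples k (C ω)).card + ((k : ℝ) - 1)) :=
        Finset.sum_le_sum fun ω _ => hpt ω
    _ = ∑ ω, ((increasingTuples k (C ω)).card : ℝ) + Fintype.card Ω * ((k : ℝ) - 1) := by
        rw [Finset.sum_add_distrib, Finset.sum_const, nsmul_eq_mul, Finset.card_univ]
    _ ≤ _ := by linarith

end Counting

/-! ### Numberings and the exchange argument -/

theorem mem_swap_mem_iff {α : Type*} [DecidableEq α] {B : Finset α} {x y : α} (h : x ∈ B ↔ y ∈ B)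
    (z : α) : Equiv.swap x y z ∈ B ↔ z ∈ B := by
  rw [Equiv.swap_apply_def]
  split_ifs with h1 h2
  · rw [h1, h]
  · rw [h2, h]
  · rfl

open Numbering in
open Classical in
/-- The numberings that have all members of `T` as prefixes. -/
noncomputable def commonPrefixed {α : Type*} [Fintype α] (T : Finset (Finset α)) :
    Finset (Numbering α) :=
  Finset.univ.filter fun ω => ∀ B ∈ T, IsPrefix ω B

theorem mem_commonPrefixed {α : Type*} [Fintype α] {T : Finset (Finset α)} {ω : Numbering α} :
    ω ∈ commonPrefixed T ↔ ∀ B ∈ T, Numbering.IsPrefix ω B := by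
  simp [commonPrefixed]

/-- Exchanging an element of `g` with one outside `g` turns a numbering with prefix `g` into one
without, and keeps the prefixes that do not separate the two elements. -/
theorem card_mul_card_commonPrefixed_le {α : Type*} [Fintype α] {T T' : Finset (Finset α)}
    {g : Finset α} (hT : T ⊆ T') (hg : g ∈ T') (D : Finset (α × α))
    (hD : ∀ p ∈ D, p.1 ∈ g ∧ p.2 ∉ g ∧ ∀ B ∈ T, p.1 ∈ B ↔ p.2 ∈ B) :
    D.card * (commonPrefixed T').card ≤ (commonPrefixed T).card := by
  classical
  rw [← Finset.card_product]
  -- The first `g.card` elements of the new numbering are `g` with `x` replaced by `y`. They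
  -- determine `x` and `y`, and then `ω`.
  refine Finset.card_le_card_of_injOn (fun p => (Equiv.swap p.1.1 p.1.2).trans p.2) ?_ ?_
  · rintro ⟨⟨x, y⟩, ω⟩ hp
    simp only [Finset.coe_product, Set.mem_prod, Finset.mem_coe, mem_commonPrefixed] at hp ⊢
    intro B hB z
    rw [← mem_swap_mem_iff ((hD _ hp.1).2.2 B hB) z]
    exact hp.2 B (hT hB) _
  · rintro ⟨⟨x, y⟩, ω⟩ hp ⟨⟨x', y'⟩, ω'⟩ hp' heq
    simp only [Finset.coe_product, Set.mem_prod, Finset.mem_coe, mem_commonPrefixed] at hp hp' heq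
    obtain ⟨hx, hy, -⟩ := hD _ hp.1
    obtain ⟨hx', hy', -⟩ := hD _ hp'.1
    have hmem : ∀ z, Equiv.swap x y z ∈ g ↔ Equiv.swap x' y' z ∈ g := by
      intro z
      rw [hp.2 g hg _, hp'.2 g hg _]
      exact iff_of_eq (congrArg (fun e : Numbering α => (e z : ℕ) < g.card) heq)
    have hxx : x = x' := by
      by_contra hne
      have h1 := (hmem x).not.1 (by simpa using hy)
      rw [Equiv.swap_apply_of_ne_of_ne hne (fun h : x = y' => hy' (by rwa [← h]))] at h1
      exact h1 hx
    have hyy : y = y' := by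
      by_contra hne
      have h1 := (hmem y).1 (by simpa using hx)
      rw [Equiv.swap_apply_of_ne_of_ne (fun h : y = x' => hy (by rwa [h])) hne] at h1
      exact hy h1
    subst hxx hyy
    have : ω = ω' := by
      ext z
      have := congrArg (fun e : Numbering α => (e (Equiv.swap x y z) : ℕ)) heq
      simpa using this
    rw [this]

theorem add_sub_one_le_mul {a b : ℕ} (ha : 0 < a) (hb : 0 < b) : a + b - 1 ≤ a * b := by
  obtain ⟨a, rfl⟩ := Nat.exists_eq_succ_of_ne_zero ha.ne'
  obtain ⟨b, rfl⟩ := Nat.exists_eq_succ_of_ne_zero hb.ne'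
  simp only [Nat.succ_eq_add_one]
  nlinarith [Nat.zero_le (a * b), show a + 1 + (b + 1) - 1 = a + b + 1 by omega]

open Classical in
/-- The pairs exchanged to destroy a prefix lying outside a chain of sets of medium size. -/
theorem exists_exchange_pairs {n : ℕ} (T : Finset (Finset (Fin n))) (g : Finset (Fin n))
    (hT : ∀ B ∈ T, n ≤ 6 * B.card ∧ n ≤ 6 * (n - B.card))
    (hg : n ≤ 6 * g.card ∧ n ≤ 6 * (n - g.card)) (hn : 12 ≤ n) (hout : IsOutside g T) :
    ∃ D : Finset (Fin n × Fin n),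
      (∀ p ∈ D, p.1 ∈ g ∧ p.2 ∉ g ∧ ∀ B ∈ T, p.1 ∈ B ↔ p.2 ∈ B) ∧ n ≤ 12 * D.card := by
  obtain ⟨A, hA, ⟨hgA, hle⟩ | ⟨hAg, hle⟩⟩ := hout
  · refine ⟨g ×ˢ (A \ g), ?_, ?_⟩
    · rintro ⟨x, y⟩ hp
      simp only [Finset.mem_product, Finset.mem_sdiff] at hp
      exact ⟨hp.1, hp.2.2, fun B hB => iff_of_true (hle B hB (hgA.le hp.1)) (hle B hB hp.2.1)⟩
    · have h1 := Finset.card_lt_card hgA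
      have h2 := hT A hA
      rw [Finset.card_product, Finset.card_sdiff_of_subset hgA.le]
      -- The number of pairs is at least `|A| - 1 ≥ n/6 - 1 ≥ n/12`, as `n ≥ 12`. In the other case
      -- `n - |A|` plays the part of `|A|`.
      have := add_sub_one_le_mul (a := g.card) (b := A.card - g.card) (by omega) (by omega)
      omega
  · refine ⟨(g \ A) ×ˢ gᶜ, ?_, ?_⟩
    · rintro ⟨x, y⟩ hp
      simp only [Finset.mem_product, Finset.mem_sdiff, Finset.mem_compl] at hp
      exact ⟨hp.1.1, hp.2, fun B hB => iff_of_false (fun h => hp.1.2 (hle B hB h))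
        (fun h => hp.2 (hAg.le (hle B hB h)))⟩
    · have h1 := Finset.card_lt_card hAg
      have h2 := hT A hA
      rw [Finset.card_product, Finset.card_sdiff_of_subset hAg.le, Finset.card_compl,
        Fintype.card_fin]
      have := add_sub_one_le_mul (a := g.card - A.card) (b := n - g.card) (by omega) (by omega)
      omega

open Numbering in
open Classical in
/-- The members of a family of sets that are prefixes of a numbering. -/
noncomputable def prefixesIn {n : ℕ} (F : Finset (Finset (Fin n))) (ω : Numbering (Fin n)) :
    Finset (Finset (Fin n)) :=
  F.filter fun A => IsPrefix ω A

theorem supersetCount_prefixesIn {n : ℕ} (F T : Finset (Finset (Fin n))) (hT : T ⊆ F) :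
    supersetCount (prefixesIn F) T =
      (commonPrefixed T).card := by
  refine supersetCount_eq_card _ fun ω => ?_
  rw [mem_commonPrefixed]
  exact ⟨fun h B hB => Finset.mem_filter.2 ⟨hT hB, h B hB⟩,
    fun h B hB => (Finset.mem_filter.1 (h hB)).2⟩

theorem supersetCount_prefixesIn_eq_zero {n : ℕ} (F T : Finset (Finset (Fin n))) (hT : ¬ T ⊆ F) :
    supersetCount (prefixesIn F) T = 0 := by
  rw [supersetCount_eq_card ∅ fun ω => ?_, Finset.card_empty]
  simp only [Finset.notMem_empty, false_iff]
  exact fun h => hT (h.trans (Finset.filter_subset _ _))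

theorem supersetCount_insert_le {n : ℕ} (hn : 12 ≤ n) (F : Finset (Finset (Fin n)))
    (hF : ∀ B ∈ F, n ≤ 6 * B.card ∧ n ≤ 6 * (n - B.card)) (T T' : Finset (Finset (Fin n)))
    (g : Finset (Fin n)) (hT' : (T' : Set (Finset (Fin n))) = insert g (T : Set (Finset (Fin n))))
    (hout : IsOutside g T) :
    (supersetCount (prefixesIn F) T' : ℝ) ≤ 12 / n * supersetCount (prefixesIn F) T := by
  classical
  obtain rfl : T' = insert g T := by
    apply Finset.coe_injective
    rw [hT', Finset.coe_insert]
  have hn0 : (0 : ℝ) < n := by exact_mod_cast (by omega : 0 < n)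
  by_cases hsub : insert g T ⊆ F
  · have hTF := (Finset.subset_insert g T).trans hsub
    obtain ⟨D, hD, hcard⟩ := exists_exchange_pairs T g (fun B hB => hF B (hTF hB))
      (hF g (hsub (Finset.mem_insert_self _ _))) hn hout
    have h := card_mul_card_commonPrefixed_le (Finset.subset_insert g T) (Finset.mem_insert_self g T) D hD
    rw [← supersetCount_prefixesIn F T hTF, ← supersetCount_prefixesIn F _ hsub] at h
    rw [div_mul_eq_mul_div, le_div_iff₀ hn0]
    have h' : supersetCount (prefixesIn F) (insert g T) * n ≤
        12 * supersetCount (prefixesIn F) T := by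
      calc _ ≤ supersetCount (prefixesIn F) (insert g T) * (12 * D.card) :=
            Nat.mul_le_mul_left _ hcard
        _ = 12 * (D.card * supersetCount (prefixesIn F) (insert g T)) := by ring
        _ ≤ _ := Nat.mul_le_mul_left _ h
    exact_mod_cast h'
  · rw [supersetCount_prefixesIn_eq_zero F _ hsub]
    push_cast
    positivity

/-! ### The upper bound for medium-sized sets -/

/-- The Lubell–Yamamoto–Meshalkin double count. -/
theorem card_mul_factorial_le {n : ℕ} (F : Finset (Finset (Fin n))) :
    F.card * n.factorial ≤ n.choose (n / 2) * ∑ ω, (prefixesIn F ω).card := by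
  classical
  have h1 : ∑ ω, (prefixesIn F ω).card = ∑ A ∈ F, (Numbering.prefixed A).card := by
    simp only [prefixesIn, Numbering.prefixed, Finset.card_filter]
    rw [Finset.sum_comm]
  rw [h1, Finset.mul_sum, ← smul_eq_mul]
  refine Finset.card_nsmul_le_sum _ _ _ fun A _ => ?_
  rw [Numbering.card_prefixed, Fintype.card_fin]
  have hA : A.card ≤ n := by simpa using A.card_le_univ
  rw [← Nat.choose_mul_factorial_mul_factorial hA, mul_assoc]
  exact Nat.mul_le_mul_right _ (Nat.choose_le_middle _ _)

theorem isChain_prefixesIn {n : ℕ} (F : Finset (Finset (Fin n))) (ω : Numbering (Fin n)) :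
    IsChain (· ≤ ·) (prefixesIn F ω : Set (Finset (Fin n))) := by
  classical
  intro A hA B hB _
  have hA := (Finset.mem_filter.1 (Finset.mem_coe.1 hA)).2
  have hB := (Finset.mem_filter.1 (Finset.mem_coe.1 hB)).2
  rcases le_total A.card B.card with h | h
  · exact Or.inl (hA.subset_of_card_le_card hB h)
  · exact Or.inr (hB.subset_of_card_le_card hA h)

/-- A family of medium-sized sets without a given tree poset of height `h` is hardly larger than
`h - 1` middle levels. -/
theorem card_le_of_isPosetFree_of_medium (P : Type*) [PartialOrder P] [Finite P]
    (hP : (SimpleGraph.hasse P).IsTree) : ∃ K : ℝ, 0 ≤ K ∧ ∀ n : ℕ, 12 ≤ n →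
      ∀ F : Finset (Finset (Fin n)), (∀ B ∈ F, n ≤ 6 * B.card ∧ n ≤ 6 * (n - B.card)) →
      IsPosetFree P (F : Set (Finset (Fin n))) →
      (F.card : ℝ) ≤ ((posetHeight P : ℝ) - 1 + K / n) * n.choose (n / 2) := by
  classical
  refine ⟨(endSegments (posetHeight P)).card * (Nat.card P : ℝ) ^ (2 * posetHeight P + 1) * 12,
    by positivity, fun n hn F hF hfree => ?_⟩
  have h := sum_card_chain_le (prefixesIn F) hP F hfree (δ := 12 / n) (by positivity)
    (isChain_prefixesIn F) (fun ω => Finset.coe_subset.2 (Finset.filter_subset _ _))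
    (supersetCount_insert_le hn F hF)
  have h2 : (F.card : ℝ) * n.factorial ≤
      n.choose (n / 2) * ∑ ω, ((prefixesIn F ω).card : ℝ) := by
    exact_mod_cast card_mul_factorial_le F
  have hΩ : Fintype.card (Numbering (Fin n)) = n.factorial := by simp
  rw [hΩ] at h
  have hpos : (0 : ℝ) < n.factorial := by exact_mod_cast n.factorial_pos
  refine le_of_mul_le_mul_right ?_ hpos
  refine h2.trans ((mul_le_mul_of_nonneg_left h (by positivity)).trans_eq ?_)
  ring

/-! ### Binomial estimates -/

/-- Up to index `n/3` each binomial coefficient is at least twice the preceding one. -/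
theorem two_pow_mul_choose_le (n i j : ℕ) (h : 3 * (i + j) ≤ n) :
    2 ^ j * n.choose i ≤ n.choose (i + j) := by
  induction j with
  | zero => simp
  | succ j ih =>
    have h1 := ih (by omega)
    have h2 := Nat.choose_succ_right_eq n (i + j)
    have h3 : 2 * n.choose (i + j) ≤ n.choose (i + j + 1) := by
      have : n.choose (i + j) * (2 * (i + j + 1)) ≤ n.choose (i + j + 1) * (i + j + 1) := by
        rw [h2]
        exact Nat.mul_le_mul_left _ (by omega)
      refine Nat.le_of_mul_le_mul_right ?_ (Nat.succ_pos (i + j))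
      linarith
    rw [pow_succ, ← add_assoc]
    linarith

theorem succ_sq_le_four_mul_two_pow (q : ℕ) : (q + 1) ^ 2 ≤ 4 * 2 ^ q := by
  induction q with
  | zero => simp
  | succ q ih =>
    rcases Nat.lt_or_ge q 2 with hq | hq
    · interval_cases q <;> norm_num
    · rw [pow_succ 2 q]
      nlinarith

/-- With `q = n / 6`, there are at most `q + 1` sizes `i`, and moving up `q` levels stays below
`n/3`, so each level is at most `2 ^ (-q)` times the middle one. This exponential gain beats `n * (q
+ 1) ≤ 6 * (q + 1) ^ 2`. -/
theorem mul_card_small_sets_le (n : ℕ) :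
    n * (Finset.univ.filter fun A : Finset (Fin n) => 6 * A.card < n).card ≤
      24 * n.choose (n / 2) := by
  classical
  set q := n / 6 with hq
  have hsub : (Finset.univ.filter fun A : Finset (Fin n) => 6 * A.card < n) ⊆
      (Finset.range (q + 1)).biUnion fun i => Finset.powersetCard i Finset.univ := by
    intro A hA
    rw [Finset.mem_filter] at hA
    exact Finset.mem_biUnion.2 ⟨A.card, Finset.mem_range.2 (by omega),
      Finset.mem_powersetCard_univ.2 rfl⟩
  have h1 : 2 ^ q * (Finset.univ.filter fun A : Finset (Fin n) => 6 * A.card < n).card ≤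
      (q + 1) * n.choose (n / 2) := by
    calc _ ≤ 2 ^ q * ∑ i ∈ Finset.range (q + 1), n.choose i := by
          refine Nat.mul_le_mul_left _ ((Finset.card_le_card hsub).trans
            (Finset.card_biUnion_le.trans_eq ?_))
          simp
      _ ≤ _ := by
          rw [Finset.mul_sum]
          refine (Finset.sum_le_card_nsmul _ _ (n.choose (n / 2)) fun i hi => ?_).trans_eq (by simp)
          rw [Finset.mem_range] at hi
          exact (two_pow_mul_choose_le n i q (by omega)).trans (Nat.choose_le_middle _ _)
  have h2 := succ_sq_le_four_mul_two_pow q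
  have hn : n ≤ 6 * (q + 1) := by omega
  refine Nat.le_of_mul_le_mul_left ?_ (show 0 < 2 ^ q by positivity)
  calc _ = n * (2 ^ q * (Finset.univ.filter fun A : Finset (Fin n) => 6 * A.card < n).card) := by
        ring
    _ ≤ 6 * (q + 1) * ((q + 1) * n.choose (n / 2)) := Nat.mul_le_mul hn h1
    _ = 6 * (q + 1) ^ 2 * n.choose (n / 2) := by ring
    _ ≤ 6 * (4 * 2 ^ q) * n.choose (n / 2) := by gcongr
    _ = _ := by ring

theorem mul_card_large_sets_le (n : ℕ) :
    n * (Finset.univ.filter fun A : Finset (Fin n) => 6 * (n - A.card) < n).card ≤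
      24 * n.choose (n / 2) := by
  classical
  refine (Nat.mul_le_mul_left n ?_).trans (mul_card_small_sets_le n)
  refine Finset.card_le_card_of_injOn compl (fun A hA => ?_) compl_injective.injOn
  simpa [Finset.card_compl] using hA

/-- Almost all subsets are of medium size. -/
theorem card_extreme_sets_le {n : ℕ} (hn : 0 < n) (F : Finset (Finset (Fin n))) :
    ((F.filter fun B => ¬ (n ≤ 6 * B.card ∧ n ≤ 6 * (n - B.card))).card : ℝ) ≤
      48 / n * n.choose (n / 2) := by
  classical
  have hn0 : (0 : ℝ) < n := by exact_mod_cast hn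
  have h : (F.filter fun B => ¬ (n ≤ 6 * B.card ∧ n ≤ 6 * (n - B.card))).card ≤
      (Finset.univ.filter fun A : Finset (Fin n) => 6 * A.card < n).card +
      (Finset.univ.filter fun A : Finset (Fin n) => 6 * (n - A.card) < n).card := by
    refine (Finset.card_le_card fun B hB => ?_).trans (Finset.card_union_le _ _)
    simp only [Finset.mem_filter, Finset.mem_union, Finset.mem_univ, true_and] at hB ⊢
    omega
  have h1 := mul_card_small_sets_le n
  have h2 := mul_card_large_sets_le n
  have h3 : (F.filter fun B => ¬ (n ≤ 6 * B.card ∧ n ≤ 6 * (n - B.card))).card * n ≤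
      48 * n.choose (n / 2) := by nlinarith
  rw [div_mul_eq_mul_div, le_div_iff₀ hn0]
  exact_mod_cast h3

/-- The levels near the middle are almost as large as the middle one. -/
theorem choose_middle_sub_ge {n : ℕ} (j : ℕ) (hj : j ≤ n / 2) :
    (n.choose (n / 2) : ℝ) * (1 - 2 * j * (j + 1) / n) ≤ n.choose (n / 2 - j) := by
  induction j with
  | zero => simp
  | succ j ih =>
    have hn : (0 : ℝ) < n := by exact_mod_cast (by omega : 0 < n)
    have ih := ih (by omega)
    obtain ⟨i, hi⟩ : ∃ i, n / 2 - j = i + 1 := ⟨n / 2 - j - 1, by omega⟩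
    have hi' : n / 2 - (j + 1) = i := by omega
    rw [hi] at ih
    rw [hi']
    have h1 : (n.choose (i + 1) : ℝ) * (i + 1) = n.choose i * (n - i) := by
      have := Nat.choose_succ_right_eq n i
      have hle : i ≤ n := by omega
      rw [← Nat.cast_sub hle]
      exact_mod_cast this
    have hni : (n : ℝ) ≤ 2 * (n - i) := by
      have : n + 2 * i ≤ 2 * n := by omega
      have : (n : ℝ) + 2 * i ≤ 2 * n := by exact_mod_cast this
      linarith
    have hdiff : (n : ℝ) - i ≤ i + 1 + (2 * j + 2) := by
      have : n ≤ i + (i + 1 + (2 * j + 2)) := by omega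
      have : (n : ℝ) ≤ i + (i + 1 + (2 * j + 2)) := by exact_mod_cast this
      linarith
    have hB : (n.choose (i + 1) : ℝ) ≤ n.choose (n / 2) := by
      exact_mod_cast Nat.choose_le_middle _ _
    set b := (n.choose (i + 1) : ℝ)
    set B := (n.choose (n / 2) : ℝ)
    have hb0 : 0 ≤ b := by positivity
    -- The loss from level `i + 1` to level `i` is `b * (n - 2i - 1) / (n - i)`, with numerator
    -- factor at most `2j + 2` and denominator at least `n/2`. These losses add up to `2 * j * (j +
    -- 1) / n`.
    have hstep : b - B * ((4 * j + 4) / n) ≤ n.choose i := by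
      have hpos : (0 : ℝ) < n - i := by linarith
      refine le_of_mul_le_mul_right ?_ hpos
      rw [← h1]
      have h2 : (2 * j + 2 : ℝ) ≤ (4 * j + 4) / n * (n - i) := by
        rw [div_mul_eq_mul_div, le_div_iff₀ hn]
        nlinarith [(Nat.cast_nonneg j : (0 : ℝ) ≤ j)]
      have h3 : b * (2 * j + 2) ≤ B * ((4 * j + 4) / n * (n - i)) :=
        mul_le_mul hB h2 (by positivity) (hb0.trans hB)
      nlinarith
    push_cast
    refine le_trans (le_of_eq ?_) ((sub_le_sub_right ih _).trans hstep)
    ring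

/-! ### Asymptotics of the extremal number -/

theorem card_le_exPoset {P : Type*} [PartialOrder P] {n : ℕ} (F : Finset (Finset (Fin n)))
    (hF : IsPosetFree P (F : Set (Finset (Fin n)))) : F.card ≤ exPoset P n := by
  classical
  exact Finset.le_sup (f := Finset.card) (by simpa using hF)

theorem exists_card_eq_exPoset (P : Type*) [PartialOrder P] [Nonempty P] (n : ℕ) :
    ∃ F : Finset (Finset (Fin n)), IsPosetFree P (F : Set (Finset (Fin n))) ∧
      F.card = exPoset P n := by
  classical
  obtain ⟨F, hF, h⟩ := Finset.exists_mem_eq_sup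
    (Finset.univ.filter fun F : Finset (Finset (Fin n)) =>
      IsPosetFree P (F : Set (Finset (Fin n))))
    ⟨∅, by
      simp only [Finset.mem_filter, Finset.mem_univ, true_and]
      rintro ⟨f, -⟩
      simpa using (f (Classical.arbitrary P)).2⟩ Finset.card
  exact ⟨F, (Finset.mem_filter.1 hF).2, h.symm⟩

theorem exPoset_le (P : Type*) [PartialOrder P] [Finite P]
    (hP : (SimpleGraph.hasse P).IsTree) : ∃ K : ℝ, 0 ≤ K ∧ ∀ n : ℕ, 12 ≤ n →
      (exPoset P n : ℝ) ≤ ((posetHeight P : ℝ) - 1 + K / n) * n.choose (n / 2) := by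
  classical
  have := hP.1.nonempty
  obtain ⟨K, hK, h⟩ := card_le_of_isPosetFree_of_medium P hP
  refine ⟨K + 48, by positivity, fun n hn => ?_⟩
  obtain ⟨F, hF, hcard⟩ := exists_card_eq_exPoset P n
  rw [← hcard, ← Finset.card_filter_add_card_filter_not
    (fun B : Finset (Fin n) => n ≤ 6 * B.card ∧ n ≤ 6 * (n - B.card))]
  have h1 := h n hn (F.filter fun B => n ≤ 6 * B.card ∧ n ≤ 6 * (n - B.card))
    (fun B hB => (Finset.mem_filter.1 hB).2) (by
      rintro ⟨f, hf, hm⟩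
      refine hF ⟨fun p => ⟨f p, (Finset.mem_filter.1 (f p).2).1⟩, fun a b hab => ?_, hm⟩
      exact hf (Subtype.ext (Subtype.mk.inj hab)))
  have h2 := card_extreme_sets_le (by omega) F
  push_cast
  refine (add_le_add h1 h2).trans_eq ?_
  ring

/-- The `posetHeight P - 1` levels from `n / 2` downwards are `P`-free, because cardinality takes
too few values on them for a longest chain of `P`. -/
theorem le_exPoset (P : Type*) [PartialOrder P] [Finite P] [Nonempty P] {n : ℕ}
    (hn : posetHeight P ≤ n / 2) :
    ((posetHeight P : ℝ) - 1) * (n.choose (n / 2) * (1 - 2 * posetHeight P ^ 2 / n)) ≤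
      exPoset P n := by
  classical
  have hpos := posetHeight_pos P
  obtain ⟨h, hh⟩ : ∃ h, posetHeight P = h + 1 := ⟨posetHeight P - 1, by omega⟩
  rw [hh] at hn ⊢
  set V := (Finset.range h).image fun j => n / 2 - j with hV
  set F : Finset (Finset (Fin n)) := V.biUnion fun i => Finset.powersetCard i Finset.univ with hF
  have hfree : IsPosetFree P (F : Set (Finset (Fin n))) := by
    refine isPosetFree_of_strictMonoOn _ Finset.card
      (fun A _ B _ hAB => Finset.card_lt_card hAB) V (fun A hA => ?_) ?_
    · obtain ⟨i, hi, hA⟩ := Finset.mem_biUnion.1 (Finset.mem_coe.1 hA)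
      rwa [Finset.mem_powersetCard_univ.1 hA]
    · refine Finset.card_image_le.trans_lt ?_
      rw [Finset.card_range, hh]
      exact Nat.lt_succ_self h
  have hcard : F.card = ∑ j ∈ Finset.range h, n.choose (n / 2 - j) := by
    rw [hF, Finset.card_biUnion fun i _ j _ hij => Finset.pairwise_disjoint_powersetCard _ hij, hV,
      Finset.sum_image]
    · simp
    · intro a ha b hb hab
      simp only [Finset.coe_range, Set.mem_Iio] at ha hb
      simp only at hab
      omega
  have hle := card_le_exPoset F hfree
  calc _ = ∑ j ∈ Finset.range h,
        (n.choose (n / 2) * (1 - 2 * ((h + 1 : ℕ) : ℝ) ^ 2 / n) : ℝ) := by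
        rw [Finset.sum_const, Finset.card_range, nsmul_eq_mul]
        push_cast
        ring
    _ ≤ ∑ j ∈ Finset.range h, (n.choose (n / 2 - j) : ℝ) := by
        refine Finset.sum_le_sum fun j hj => ?_
        rw [Finset.mem_range] at hj
        refine le_trans ?_ (choose_middle_sub_ge j (by omega))
        refine mul_le_mul_of_nonneg_left ?_ (by positivity)
        have hjh : (j : ℝ) ≤ h := by exact_mod_cast hj.le
        have h0 : (0 : ℝ) ≤ j := by positivity
        gcongr ?_ - ?_ / _
        push_cast
        nlinarith
    _ ≤ _ := by
        rw [hcard] at hle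
        exact_mod_cast hle

theorem exPoset_eq_zero_of_subsingleton (P : Type*) [PartialOrder P] [Nonempty P]
    [Subsingleton P] (n : ℕ) : exPoset P n = 0 := by
  obtain ⟨F, hF, h⟩ := exists_card_eq_exPoset P n
  rw [← h, Finset.card_eq_zero, Finset.eq_empty_iff_forall_notMem]
  exact fun A hA => hF ⟨fun _ => ⟨A, hA⟩, fun a b _ => Subsingleton.elim a b,
    fun _ _ _ => le_rfl⟩

theorem subsingleton_of_posetHeight_eq_one (P : Type*) [PartialOrder P] [Finite P]
    (hP : (SimpleGraph.hasse P).IsTree) (h : posetHeight P = 1) : Subsingleton P := by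
  by_contra hns
  rw [not_subsingleton_iff_nontrivial] at hns
  obtain ⟨r, hr⟩ := exists_strictMono_fin_posetHeight P
  have := (Fin.subsingleton_iff_le_one).2 h.le
  obtain ⟨v⟩ := hP.1.nonempty
  obtain ⟨w, hw⟩ := hP.1.preconnected.exists_adj_of_nontrivial v
  rcases hw with hw | hw <;> exact (hr hw.lt).ne (Subsingleton.elim _ _)

theorem exists_exPoset_eq (P : Type*) [PartialOrder P] [Finite P]
    (hP : (SimpleGraph.hasse P).IsTree) :
    ∃ ε : ℕ → ℝ, ε =O[Filter.atTop] (fun n : ℕ => 1 / (n : ℝ)) ∧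
      ∀ n : ℕ, (exPoset P n : ℝ) =
        ((posetHeight P : ℝ) - 1) * (n.choose (n / 2) : ℝ) * (1 + ε n) := by
  have := hP.1.nonempty
  have hpos := posetHeight_pos P
  -- At height one the main term vanishes, so the extremal number has to be exactly zero; it is,
  -- because a connected Hasse diagram of height one is a single point.
  rcases Nat.eq_or_lt_of_le (Nat.succ_le_of_lt hpos) with h1 | h1
  · have := subsingleton_of_posetHeight_eq_one P hP h1.symm
    refine ⟨0, Asymptotics.isBigO_zero _ _, fun n => ?_⟩
    rw [exPoset_eq_zero_of_subsingleton, ← h1]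
    simp
  have hB : ∀ n : ℕ, (0 : ℝ) < n.choose (n / 2) := fun n => by
    exact_mod_cast Nat.choose_pos (Nat.div_le_self n 2)
  have hh : (1 : ℝ) ≤ (posetHeight P : ℝ) - 1 := by
    have : (2 : ℝ) ≤ posetHeight P := by exact_mod_cast h1
    linarith
  obtain ⟨K, hK, hup⟩ := exPoset_le P hP
  set h : ℝ := (posetHeight P : ℝ) - 1 with hdef
  refine ⟨fun n => exPoset P n / (h * n.choose (n / 2)) - 1, ?_, fun n => ?_⟩
  · refine Asymptotics.IsBigO.of_bound (K + 2 * posetHeight P ^ 2) ?_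
    filter_upwards [Filter.eventually_ge_atTop (max 12 (2 * posetHeight P))] with n hn
    have hn12 : 12 ≤ n := (le_max_left _ _).trans hn
    have hn2 : posetHeight P ≤ n / 2 := by
      have := (le_max_right _ _).trans hn
      omega
    have hn0 : (0 : ℝ) < n := by exact_mod_cast (by omega : 0 < n)
    have hhB : 0 < h * n.choose (n / 2) := mul_pos (by linarith) (hB n)
    have hu := hup n hn12
    have hl := le_exPoset P hn2
    rw [← hdef] at hl
    rw [Real.norm_eq_abs, Real.norm_eq_abs, abs_of_pos (by positivity : (0 : ℝ) < 1 / n), abs_le,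
      mul_one_div, neg_le_sub_iff_le_add, sub_le_iff_le_add]
    constructor
    · rw [← sub_le_iff_le_add, le_div_iff₀ hhB]
      refine le_trans ?_ hl
      have : 0 ≤ h * n.choose (n / 2) * (K / n) := by positivity
      rw [add_div]
      nlinarith
    · rw [div_le_iff₀ hhB]
      refine hu.trans ?_
      have h1 : K / n ≤ h * (K / n) := le_mul_of_one_le_left (by positivity) hh
      have h2 : 0 ≤ h * (2 * posetHeight P ^ 2 / n : ℝ) := by positivity
      calc _ ≤ (h + h * (K / n) + h * (2 * posetHeight P ^ 2 / n)) * n.choose (n / 2) := by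
            refine mul_le_mul_of_nonneg_right ?_ (hB n).le
            linarith
        _ = _ := by ring
  · have hhB : h * n.choose (n / 2) ≠ 0 := (mul_pos (by linarith) (hB n)).ne'
    rw [add_sub_cancel, mul_div_cancel₀ _ hhB]

/-! ### Levels of `MonZ` -/

/-- The indicator function of `{n | -d ≤ n}`. -/
def monStep (d : ℤ) : MonZ :=
  ⟨fun n => if -d ≤ n then 1 else 0, by
    filter_upwards [Filter.eventually_gt_atTop |d|] with n hn
    rw [abs_lt] at hn
    exact ⟨if_pos (by omega), if_neg (by omega)⟩⟩

/-- The surplus of ones of a member of `MonZ` compared to the indicator function of the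
nonnegative integers. -/
noncomputable def monDegree (f : MonZ) : ℤ :=
  ∑ᶠ n : ℤ, monDiff f (monStep 0) n

theorem finsum_monDiff (f g : MonZ) : ∑ᶠ n : ℤ, monDiff f g n = monDegree f - monDegree g := by
  rw [monDegree, monDegree, ← finsum_sub_distrib (monDiff_finite_support _ _)
    (monDiff_finite_support _ _)]
  refine finsum_congr fun n => ?_
  simp [monDiff]

theorem monDegree_strictMono : StrictMono monDegree := by
  intro f g hfg
  rw [← sub_pos, ← finsum_monDiff]
  have hle : ∀ n, f.1 n ≤ g.1 n := hfg.le
  obtain ⟨n, hn⟩ : ∃ n, f.1 n < g.1 n := (Pi.lt_def.1 hfg).2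
  refine finsum_pos (fun i => ?_) ⟨n, ?_⟩ (monDiff_finite_support g f)
  · have := Fin.le_def.1 (hle i)
    simp only [monDiff]
    omega
  · have := Fin.lt_def.1 hn
    simp only [monDiff]
    omega

/-- Turning finitely many zeros into ones raises the degree by their number. -/
theorem monDegree_eq_add_card {f g : MonZ} (s : Finset ℤ)
    (hs : ∀ n ∈ s, f.1 n = 0 ∧ g.1 n = 1) (hns : ∀ n ∉ s, f.1 n = g.1 n) :
    monDegree g = monDegree f + s.card := by
  rw [← sub_eq_iff_eq_add', ← finsum_monDiff,
    finsum_eq_sum_of_support_subset (s := s) _ fun n hn => ?_]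
  · rw [Finset.sum_congr rfl fun n hn => show monDiff g f n = 1 by simp [monDiff, hs n hn]]
    simp
  · by_contra h
    exact hn (by simp [monDiff, hns n h])

theorem monDegree_monStep (d : ℤ) : monDegree (monStep d) = d := by
  have hstep : ∀ d, monDegree (monStep (d + 1)) = monDegree (monStep d) + 1 := by
    intro d
    refine (monDegree_eq_add_card (f := monStep d) {-(d + 1)} (fun n hn => ?_) fun n hn => ?_).trans (by simp)
    · rw [Finset.mem_singleton] at hn
      exact ⟨if_neg (by omega), if_pos (by omega)⟩
    · rw [Finset.mem_singleton] at hn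
      simp only [monStep]
      congr 1
      rw [eq_iff_iff]
      omega
  induction d using Int.induction_on with
  | zero => simp [monDegree, monDiff]
  | succ i ih => rw [hstep, ih]
  | pred i ih =>
    have := hstep (-i - 1)
    rw [sub_add_cancel, ih] at this
    omega

/-- Having differences that sum to zero is equality of degrees, so maximal families are the full
degree classes; `monStep` shows that no class is empty. -/
theorem isMonLevel_iff {L : Set MonZ} : IsMonLevel L ↔ ∃ d, L = {f | monDegree f = d} := by
  constructor
  · intro hL
    have hne : L.Nonempty := by
      rw [Set.nonempty_iff_ne_empty]
      rintro rfl
      have := hL.2 (y := {monStep 0}) (by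
        rintro f rfl g rfl
        rw [finsum_monDiff, sub_self]) (Set.empty_subset _)
      exact this rfl
    obtain ⟨f, hf⟩ := hne
    refine ⟨monDegree f, Set.Subset.antisymm (fun g hg => ?_) ?_⟩
    · have := hL.1 g hg f hf
      rwa [finsum_monDiff, sub_eq_zero] at this
    · refine hL.2 (fun g hg g' hg' => ?_) fun g hg => ?_
      · rw [finsum_monDiff, hg, hg', sub_self]
      · have := hL.1 g hg f hf
        rwa [finsum_monDiff, sub_eq_zero] at this
  · rintro ⟨d, rfl⟩
    refine ⟨fun f hf g hg => by rw [finsum_monDiff, hf, hg, sub_self], fun K hK hsub f hf => ?_⟩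
    have := hK f hf _ (hsub (show monStep d ∈ _ from monDegree_monStep d))
    rwa [finsum_monDiff, monDegree_monStep, sub_eq_zero] at this

theorem level_injective : Function.Injective fun d : ℤ => {f | monDegree f = d} := by
  intro d e h
  have : monStep d ∈ {f | monDegree f = e} := by
    rw [← show {f | monDegree f = d} = {f | monDegree f = e} from h]
    exact monDegree_monStep d
  rw [← monDegree_monStep d]
  exact this

/-- The function equal to `v` on the finite set `s` and to `f` elsewhere. -/
def monModify (f : MonZ) (s : Finset ℤ) (v : Fin 2) : MonZ :=
  ⟨fun n => if n ∈ s then v else f.1 n, by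
    have h : ∀ᶠ n : ℤ in Filter.atTop, ∀ x ∈ s, |x| < n :=
      (Filter.eventually_all_finset s).2 fun x _ => Filter.eventually_gt_atTop |x|
    filter_upwards [f.2, h] with n hn hs
    rw [if_neg, if_neg]
    · exact hn
    · intro hmem
      have := hs _ hmem
      rw [abs_lt] at this
      omega
    · intro hmem
      have := hs _ hmem
      rw [abs_lt] at this
      omega⟩

theorem exists_common_threshold (S : Finset MonZ) :
    ∃ N : ℤ, ∀ g ∈ S, ∀ n, N ≤ n → g.1 n = 1 ∧ g.1 (-n) = 0 := by
  have h : ∀ᶠ n : ℤ in Filter.atTop, ∀ g ∈ S, g.1 n = 1 ∧ g.1 (-n) = 0 :=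
    (Filter.eventually_all_finset S).2 fun g _ => g.2
  obtain ⟨N, hN⟩ := Filter.eventually_atTop.1 h
  exact ⟨N, fun g hg n hn => hN n hn g hg⟩

/-- The increasing tuples with prescribed degrees. -/
def tuplesOfDegree {k : ℕ} (d : Fin k → ℤ) : Set (Fin k → MonZ) :=
  {t | Monotone t ∧ ∀ i, monDegree (t i) = d i}

theorem strictMono_of_mem_tuplesOfDegree {k : ℕ} {d : Fin k → ℤ} (hd : StrictMono d)
    {t : Fin k → MonZ} (ht : t ∈ tuplesOfDegree d) : StrictMono t :=
  ht.1.strictMono_of_injective fun i j hij => hd.injective (by rw [← ht.2, ← ht.2, hij])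

theorem tuplesOfDegree_nonempty {k : ℕ} {d : Fin k → ℤ} (hd : StrictMono d) :
    (tuplesOfDegree d).Nonempty := by
  refine ⟨fun i => monStep (d i), fun i j hij n => ?_, fun i => monDegree_monStep _⟩
  have := hd.monotone hij
  simp only [monStep]
  split_ifs
  · exact le_rfl
  · omega
  · exact Fin.zero_le _
  · exact le_rfl

/-- Beyond a common threshold `N` all members of `S` and `t a` are constant on each side. Altering
`t a` there adjusts the degree at will and leaves `S`. -/
theorem isFlexible_tuplesOfDegree {k : ℕ} {d : Fin k → ℤ} (hd : StrictMono d) (m : ℕ) :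
    IsFlexible m (tuplesOfDegree d) := by
  classical
  rintro t ht a u hu S -
  obtain ⟨N, hN⟩ := exists_common_threshold (insert (t a) S)
  have hta := hN (t a) (Finset.mem_insert_self _ _)
  rcases hu with rfl | rfl
  · let s : Fin k → Finset ℤ := fun i => Finset.Ico N (N + (d a - d i))
    refine ⟨fun i => if a ≤ i then t i else monModify (t a) (s i) 0, ⟨fun i j hij n => ?_,
      fun i => ?_⟩, fun i hi => if_pos (by simpa using hi), fun i hi hS => ?_⟩
    · have hdij := hd.monotone hij
      by_cases hi : a ≤ i
      · simp only [if_pos hi, if_pos (hi.trans hij)]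
        exact ht.1 hij n
      · by_cases hj : a ≤ j
        · simp only [if_neg hi, if_pos hj, monModify]
          split_ifs
          · exact Fin.zero_le _
          · exact ht.1 hj n
        · simp only [if_neg hi, if_neg hj, monModify, s, Finset.mem_Ico]
          split_ifs
          · exact le_rfl
          · exact Fin.zero_le _
          · omega
          · exact le_rfl
    · by_cases hi : a ≤ i
      · simp only [if_pos hi]
        exact ht.2 i
      · simp only [if_neg hi]
        have hdi := hd (not_le.1 hi)
        have := monDegree_eq_add_card (f := monModify (t a) (s i) 0) (g := t a) (s i)
          (fun n hn => ⟨if_pos hn, (hta n (Finset.mem_Ico.1 hn).1).1⟩) (fun n hn => if_neg hn)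
        rw [ht.2, Int.card_Ico] at this
        omega
    · have hi : ¬ a ≤ i := by simpa using hi
      have hdi := hd (not_le.1 hi)
      simp only [if_neg hi] at hS
      have h1 := (hN _ (Finset.mem_insert_of_mem hS) N le_rfl).1
      simp only [monModify, s, Finset.mem_Ico] at h1
      rw [if_pos (by omega)] at h1
      exact absurd h1 (by decide)
  · let s : Fin k → Finset ℤ := fun i => Finset.Ioc (-N - (d i - d a)) (-N)
    refine ⟨fun i => if i ≤ a then t i else monModify (t a) (s i) 1, ⟨fun i j hij n => ?_,
      fun i => ?_⟩, fun i hi => if_pos (by simpa using hi), fun i hi hS => ?_⟩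
    · have hdij := hd.monotone hij
      by_cases hj : j ≤ a
      · simp only [if_pos hj, if_pos (hij.trans hj)]
        exact ht.1 hij n
      · by_cases hi : i ≤ a
        · simp only [if_neg hj, if_pos hi, monModify]
          split_ifs
          · exact Fin.le_last _
          · exact ht.1 hi n
        · simp only [if_neg hi, if_neg hj, monModify, s, Finset.mem_Ioc]
          split_ifs
          · exact le_rfl
          · omega
          · exact Fin.le_last _
          · exact le_rfl
    · by_cases hi : i ≤ a
      · simp only [if_pos hi]
        exact ht.2 i
      · simp only [if_neg hi]
        have hdi := hd (not_le.1 hi)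
        have := monDegree_eq_add_card (f := t a) (g := monModify (t a) (s i) 1) (s i)
          (fun n hn => ⟨by
            have := (Finset.mem_Ioc.1 hn).2
            simpa using (hta (-n) (by omega)).2, if_pos hn⟩) (fun n hn => (if_neg hn).symm)
        rw [ht.2, Int.card_Ioc] at this
        omega
    · have hi : ¬ i ≤ a := by simpa using hi
      have hdi := hd (not_le.1 hi)
      simp only [if_neg hi] at hS
      have h1 := (hN _ (Finset.mem_insert_of_mem hS) N le_rfl).2
      simp only [monModify, s, Finset.mem_Ioc] at h1
      rw [if_pos (by omega)] at h1
      exact absurd h1 (by decide)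

theorem isGreatest_freeLevelCounts (P : Type*) [PartialOrder P] [Finite P]
    (hP : (SimpleGraph.hasse P).IsTree) :
    IsGreatest (freeLevelCounts P) ((posetHeight P - 1 : ℕ) : ℕ∞) := by
  have := hP.1.nonempty
  have hpos := posetHeight_pos P
  constructor
  · refine ⟨(fun d : ℤ => {f | monDegree f = d}) ''
      (Finset.Ico (0 : ℤ) (posetHeight P - 1 : ℕ) : Finset ℤ), ?_, ?_, ?_⟩
    · rintro _ ⟨d, -, rfl⟩
      exact isMonLevel_iff.2 ⟨d, rfl⟩
    · refine isPosetFree_of_strictMonoOn _ monDegree (monDegree_strictMono.strictMonoOn _)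
        (Finset.Ico (0 : ℤ) (posetHeight P - 1 : ℕ)) ?_ ?_
      · rintro f ⟨_, ⟨d, hd, rfl⟩, hf⟩
        rw [show monDegree f = d from hf]
        exact hd
      · rw [Int.card_Ico]
        omega
    · rw [level_injective.encard_image, Set.encard_coe_eq_coe_finsetCard, Int.card_Ico]
      simp
  · rintro _ ⟨S, hS, hfree, rfl⟩
    by_contra! hlt
    have hge : (posetHeight P : ℕ∞) ≤ S.encard := by
      have := Order.add_one_le_of_lt hlt
      rwa [← Nat.cast_add_one, Nat.sub_add_cancel hpos] at this
    have himg : S = (fun d : ℤ => {f | monDegree f = d}) ''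
        ((fun d : ℤ => {f | monDegree f = d}) ⁻¹' S) := by
      rw [Set.image_preimage_eq_of_subset]
      intro L hL
      obtain ⟨d, rfl⟩ := isMonLevel_iff.1 (hS L hL)
      exact ⟨d, rfl⟩
    rw [himg, level_injective.encard_image] at hge
    -- Any `posetHeight P` of the degrees will do, listed in increasing order; they need not be
    -- consecutive.
    obtain ⟨D, hDS, hD⟩ := Set.exists_subset_encard_eq hge
    have hfin : D.Finite := Set.finite_of_encard_eq_coe hD
    have hcard : hfin.toFinset.card = posetHeight P := by
      rw [hfin.encard_eq_coe_toFinset_card] at hD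
      exact_mod_cast hD
    let d := hfin.toFinset.orderEmbOfFin hcard
    have hd : StrictMono d := d.strictMono
    refine hfree (isSubposet_of_isFlexible hP _ (tuplesOfDegree d) (tuplesOfDegree_nonempty hd)
      (fun t ht => strictMono_of_mem_tuplesOfDegree hd ht) (fun t ht i => ?_)
      (isFlexible_tuplesOfDegree hd _))
    have hmem : d i ∈ D :=
      hfin.mem_toFinset.1 (hfin.toFinset.orderEmbOfFin_mem hcard i)
    exact ⟨_, hDS hmem, ht.2 i⟩

theorem theorem1 (P : Type*) [PartialOrder P] [Finite P]
    (hP : (SimpleGraph.hasse P).IsTree) :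
    (∃ ε : ℕ → ℝ,
      ε =O[Filter.atTop] (fun n : ℕ => 1 / (n : ℝ)) ∧
      ∀ n : ℕ, (exPoset P n : ℝ) =
        ((posetHeight P : ℝ) - 1) * (n.choose (n / 2) : ℝ) * (1 + ε n)) ∧
    IsGreatest (freeLevelCounts P) ((posetHeight P - 1 : ℕ) : ℕ∞) :=
  ⟨exists_exPoset_eq P hP, isGreatest_freeLevelCounts P hP⟩
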